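/- An ultragraph $\mathcal{G}=(G^0,\mathcal{G}^1,r,s)$ consists of a countable set $G^0$ of vertices, a countable set $\mathcal{G}^1$ of edges, and maps $s:\mathcal{G}^1\to G^0$ and $r:\mathcal{G}^1\to\mathcal{P}(G^0)\setminus\{\varnothing\}$. Let $\mathcal{G}^0$ be the smallest family of subsets of $G^0$ that contains $\varnothing$, all $\{v\}$ $(v\in G^0)$ and all $r(e)$ $(e\in\mathcal{G}^1)$ and is closed under relative complements, finite unions and finite intersections. For a field $K$, the Leavitt path algebra $L_K(\mathcal{G})$ is the (not necessarily unital) associative $K$-algebra generated by $\{p_A\mid A\in\mathcal{G}^0\}\cup\{s_e,s_e^*\mid e\in\mathcal{G}^1\}$ subject to the following relations, for all $A,B\in\mathcal{G}^0$ and $e,f\in\mathcal{G}^1$, where $p_v:=p_{\{v\}}$: $p_\varnothing=0$, $p_Ap_B=p_{A\cap B}$, $p_{A\cup B}=p_A+p_B-p_{A\cap B}$; $p_{s(e)}s_e=s_e=s_ep_{r(e)}$, $p_{r(e)}s_e^*=s_e^*=s_e^*p_{s(e)}$; $s_e^*s_f=\delta_{e,f}\,p_{r(e)}$; and $p_v=\sum_{s(e)=v}s_es_e^*$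 whenever $0<|s^{-1}(v)|<\infty$. A finite path is either some $A\in\mathcal{G}^0$ (of length $0$, with $s_A=s_A^*=p_A$), or a sequence $\alpha=e_1\cdots e_n$ of $n\ge 1$ edges with $s(e_{i+1})\in r(e_i)$ for $1\le i<n$ (of length $|\alpha|=n$, with $s_\alpha=s_{e_1}\cdots s_{e_n}$ and $s_\alpha^*=s_{e_n}^*\cdots s_{e_1}^*$). The algebra $L_K(\mathcal{G})$ is $\mathbb{Z}$-graded by $L_K(\mathcal{G})_n=\mathrm{Span}_K\{s_\alpha p_As_\beta^*\mid \alpha,\beta \text{ finite paths},\ A\in\mathcal{G}^0,\ |\alpha|-|\beta|=n\}$. A two-sided ideal $I$ is graded if $I=\bigoplus_{n\in\mathbb{Z}}(I\cap L_K(\mathcal{G})_n)$. For a two-sided ideal $I$ of $L_K(\mathcal{G})$ put $\mathcal{H}_I=\{A\in\mathcal{G}^0\mid p_A\in I\}$, and let $B_{\mathcal{H}_I}$, the set of breaking vertices of $\mathcal{H}_I$, be the set of all $v\in G^0$ with $|s^{-1}(v)|=\infty$ and $0<|\{e\in s^{-1}(v)\mid r(e)\notin\mathcal{H}_I\}|<\infty$.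 For $v\in B_{\mathcal{H}_I}$ let $$p_v^{\mathcal{H}_I}=p_v-\sum_{e\in s^{-1}(v),\ r(e)\notin\mathcal{H}_I}s_es_e^*,$$ and put $S_I=\{v\in B_{\mathcal{H}_I}\mid p_v^{\mathcal{H}_I}\in I\}$. Theorem. Let $K$ be a field, $\mathcal{G}$ an ultragraph, and $I$ a two-sided ideal of $L_K(\mathcal{G})$. Then the following are equivalent: (1) $I$ is a graded ideal; (2) $I$ is generated, as a two-sided ideal, by a set of elements of the form $p_A-\sum_{e\in S}s_es_e^*$, where $A\in\mathcal{G}^0$ and $S$ is a finite subset of $\mathcal{G}^1$ consisting of edges with the same source vertex $v\in A$; (3) $I$ is generated, as a two-sided ideal, by the set $\{p_A\mid A\in\mathcal{H}_I\}\cup\{p_v^{\mathcal{H}_I}\mid v\in S_I\}$. -/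

import Mathlib

/-- An ultragraph with vertex set `V` and edge set `E`: every edge has a source vertex and a
nonempty set of vertices as its range. (Countability of `V` and `E` is a separate hypothesis.) -/
structure Ultragraph (V : Type*) (E : Type*) where
  source : E → V
  range : E → Set V
  range_nonempty : ∀ e, (range e).Nonempty

namespace Ultragraph

universe u v w

variable {V : Type v} {E : Type w}

/-- Membership in the smallest family of subsets of `V` containing the singletons and the ranges
of edges, and closed under relative complements, finite unions (the empty union included) and
finite intersections. -/
inductive IsGeneralizedVertex (G : Ultragraph V E) : Set V → Prop
  | empty : IsGeneralizedVertex G ∅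
  | single (v : V) : IsGeneralizedVertex G {v}
  | range (e : E) : IsGeneralizedVertex G (G.range e)
  | union {A B : Set V} : IsGeneralizedVertex G A → IsGeneralizedVertex G B →
      IsGeneralizedVertex G (A ∪ B)
  | inter {A B : Set V} : IsGeneralizedVertex G A → IsGeneralizedVertex G B →
      IsGeneralizedVertex G (A ∩ B)
  | diff {A B : Set V} : IsGeneralizedVertex G A → IsGeneralizedVertex G B →
      IsGeneralizedVertex G (A \ B)

/-- The generalized vertices of `G`. -/
def GeneralizedVertex (G : Ultragraph V E) : Type v := {A : Set V // G.IsGeneralizedVertex A}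

namespace GeneralizedVertex

variable {G : Ultragraph V E}

/-- The empty generalized vertex. -/
def empty (G : Ultragraph V E) : G.GeneralizedVertex := ⟨∅, .empty⟩

/-- The generalized vertex `{v}`. -/
def single (G : Ultragraph V E) (v : V) : G.GeneralizedVertex := ⟨{v}, .single v⟩

/-- The generalized vertex `r(e)`. -/
def ofRange (G : Ultragraph V E) (e : E) : G.GeneralizedVertex := ⟨G.range e, .range e⟩

/-- The union of two generalized vertices. -/
def union (A B : G.GeneralizedVertex) : G.GeneralizedVertex := ⟨A.1 ∪ B.1, A.2.union B.2⟩

/-- The intersection of two generalized vertices. -/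
def inter (A B : G.GeneralizedVertex) : G.GeneralizedVertex := ⟨A.1 ∩ B.1, A.2.inter B.2⟩

end GeneralizedVertex

/-- The set `s⁻¹(v)` of edges with source `v`. -/
def emitted (G : Ultragraph V E) (v : V) : Set E := {e | G.source e = v}

/-- The symbols generating the Leavitt path algebra: `p_A`, `s_e` and `s_e^*`. -/
inductive Generator (G : Ultragraph V E) : Type (max v w)
  | p (A : G.GeneralizedVertex) : Generator G
  | s (e : E) : Generator G
  | sStar (e : E) : Generator G

section Algebra

variable (K : Type u) [Field K] (G : Ultragraph V E)

/-- The free unital `K`-algebra on the symbols `p_A`, `s_e`, `s_e^*`. -/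
abbrev FreeOn : Type (max u v w) := FreeAlgebra K G.Generator

variable {G} in
/-- The symbol `p_A` in the free algebra. -/
abbrev freeP (A : G.GeneralizedVertex) : FreeOn K G := FreeAlgebra.ι K (Generator.p A)

/-- The symbol `s_e` in the free algebra. -/
abbrev freeS (e : E) : FreeOn K G := FreeAlgebra.ι K (Generator.s e)

/-- The symbol `s_e^*` in the free algebra. -/
abbrev freeStar (e : E) : FreeOn K G := FreeAlgebra.ι K (Generator.sStar e)

/-- The defining relations of the Leavitt path algebra of an ultragraph. -/
inductive Rel : FreeOn K G → FreeOn K G → Prop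
  | p_empty : Rel (freeP K (GeneralizedVertex.empty G)) 0
  | p_inter (A B : G.GeneralizedVertex) :
      Rel (freeP K A * freeP K B) (freeP K (A.inter B))
  | p_union (A B : G.GeneralizedVertex) :
      Rel (freeP K (A.union B)) (freeP K A + freeP K B - freeP K (A.inter B))
  | source_s (e : E) :
      Rel (freeP K (GeneralizedVertex.single G (G.source e)) * freeS K G e) (freeS K G e)
  | s_range (e : E) :
      Rel (freeS K G e * freeP K (GeneralizedVertex.ofRange G e)) (freeS K G e)
  | range_star (e : E) :
      Rel (freeP K (GeneralizedVertex.ofRange G e) * freeStar K G e) (freeStar K G e)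
  | star_source (e : E) :
      Rel (freeStar K G e * freeP K (GeneralizedVertex.single G (G.source e))) (freeStar K G e)
  | star_s_self (e : E) :
      Rel (freeStar K G e * freeS K G e) (freeP K (GeneralizedVertex.ofRange G e))
  | star_s_ne (e f : E) (h : e ≠ f) :
      Rel (freeStar K G e * freeS K G f) 0
  | regular (v : V) (hne : (G.emitted v).Nonempty) (hfin : (G.emitted v).Finite) :
      Rel (freeP K (GeneralizedVertex.single G v))
        (∑ e ∈ hfin.toFinset, freeS K G e * freeStar K G e)

/-- The unital `K`-algebra presented by the symbols and the defining relations. -/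
abbrev UnitalEnvelope : Type (max u v w) := RingQuot (Rel K G)

/-- The class of a generating symbol in the unital envelope. -/
def envelopeGen (x : G.Generator) : UnitalEnvelope K G :=
  RingQuot.mkAlgHom K (Rel K G) (FreeAlgebra.ι K x)

/-- The Leavitt path algebra `L_K(G)`: the (not necessarily unital) `K`-algebra generated by the
`p_A`, `s_e`, `s_e^*` subject to the defining relations. As the relations have no constant terms,
it is the non-unital subalgebra generated by the symbols inside the unital algebra with the same
presentation; its universal property among non-unital `K`-algebras is
`Ultragraph.existsUnique_lift` below. -/
abbrev LeavittPathAlgebra : Type (max u v w) :=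
  ↥(NonUnitalAlgebra.adjoin K (Set.range (envelopeGen K G)))

/-- A generator of `L_K(G)`. -/
def gen (x : G.Generator) : LeavittPathAlgebra K G :=
  ⟨envelopeGen K G x, NonUnitalAlgebra.subset_adjoin K ⟨x, rfl⟩⟩

variable {G} in
/-- The element `p_A` of `L_K(G)`. -/
def p (A : G.GeneralizedVertex) : LeavittPathAlgebra K G := gen K G (Generator.p A)

/-- The element `s_e` of `L_K(G)`. -/
def s (e : E) : LeavittPathAlgebra K G := gen K G (Generator.s e)

/-- The element `s_e^*` of `L_K(G)`. -/
def sStar (e : E) : LeavittPathAlgebra K G := gen K G (Generator.sStar e)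

variable {K} in
/-- A family `b_A, c_e, d_e` in a non-unital `K`-algebra satisfies the relations of `L_K(G)`. -/
structure IsLeavittFamily {R : Type*} [NonUnitalRing R]
    (b : G.GeneralizedVertex → R) (c d : E → R) : Prop where
  p_empty : b (GeneralizedVertex.empty G) = 0
  p_inter : ∀ A B : G.GeneralizedVertex, b A * b B = b (A.inter B)
  p_union : ∀ A B : G.GeneralizedVertex, b (A.union B) = b A + b B - b (A.inter B)
  source_s : ∀ e, b (GeneralizedVertex.single G (G.source e)) * c e = c e
  s_range : ∀ e, c e * b (GeneralizedVertex.ofRange G e) = c e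
  range_star : ∀ e, b (GeneralizedVertex.ofRange G e) * d e = d e
  star_source : ∀ e, d e * b (GeneralizedVertex.single G (G.source e)) = d e
  star_s_self : ∀ e, d e * c e = b (GeneralizedVertex.ofRange G e)
  star_s_ne : ∀ e f, e ≠ f → d e * c f = 0
  regular : ∀ v, (G.emitted v).Nonempty → ∀ hfin : (G.emitted v).Finite,
    b (GeneralizedVertex.single G v) = ∑ e ∈ hfin.toFinset, c e * d e

/-- The generators of `L_K(G)` satisfy the defining relations. -/
theorem isLeavittFamily_gen : G.IsLeavittFamily (p K) (s K G) (sStar K G) := by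
  have key : ∀ {a b : FreeOn K G}, Rel K G a b →
      RingQuot.mkAlgHom K (Rel K G) a = RingQuot.mkAlgHom K (Rel K G) b :=
    fun h => RingQuot.mkAlgHom_rel K h
  constructor
  · exact Subtype.ext ((key Rel.p_empty).trans (map_zero _))
  · exact fun A B => Subtype.ext ((map_mul _ _ _).symm.trans (key (Rel.p_inter A B)))
  · exact fun A B => Subtype.ext ((key (Rel.p_union A B)).trans
      ((map_sub _ _ _).trans (congrArg (· - _) (map_add _ _ _))))
  · exact fun e => Subtype.ext ((map_mul _ _ _).symm.trans (key (Rel.source_s e)))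
  · exact fun e => Subtype.ext ((map_mul _ _ _).symm.trans (key (Rel.s_range e)))
  · exact fun e => Subtype.ext ((map_mul _ _ _).symm.trans (key (Rel.range_star e)))
  · exact fun e => Subtype.ext ((map_mul _ _ _).symm.trans (key (Rel.star_source e)))
  · exact fun e => Subtype.ext ((map_mul _ _ _).symm.trans (key (Rel.star_s_self e)))
  · exact fun e f h => Subtype.ext
      ((map_mul _ _ _).symm.trans ((key (Rel.star_s_ne e f h)).trans (map_zero _)))
  · intro v hne hfin
    refine Subtype.ext ((key (Rel.regular v hne hfin)).trans ?_)
    refine (map_sum _ _ _).trans (Eq.trans ?_ (AddSubmonoidClass.coe_finsetSum _ _).symm)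
    exact Finset.sum_congr rfl fun e _ => map_mul _ _ _

/-- The universal property of `L_K(G)` among non-unital associative `K`-algebras. -/
theorem existsUnique_lift {R : Type*} [NonUnitalRing R] [Module K R] [IsScalarTower K R R]
    [SMulCommClass K R R] (b : G.GeneralizedVertex → R) (c d : E → R)
    (h : G.IsLeavittFamily b c d) :
    ∃! φ : LeavittPathAlgebra K G →ₙₐ[K] R,
      (∀ A, φ (p K A) = b A) ∧ (∀ e, φ (s K G e) = c e) ∧ ∀ e, φ (sStar K G e) = d e := by
  let g : G.Generator → Unitization K R := fun x => Unitization.inr (match x with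
    | .p A => b A
    | .s e => c e
    | .sStar e => d e)
  have hg : ∀ ⦃x y : FreeOn K G⦄, Rel K G x y →
      FreeAlgebra.lift K g x = FreeAlgebra.lift K g y := by
    intro x y hxy
    induction hxy with
    | p_empty => simp [g, h.p_empty]
    | p_inter A B => simp [g, ← Unitization.inr_mul K, h.p_inter]
    | p_union A B =>
      simp [g, ← Unitization.inr_add, ← Unitization.inr_sub, h.p_union]
    | source_s e => simp [g, ← Unitization.inr_mul K, h.source_s]
    | s_range e => simp [g, ← Unitization.inr_mul K, h.s_range]
    | range_star e => simp [g, ← Unitization.inr_mul K, h.range_star]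
    | star_source e => simp [g, ← Unitization.inr_mul K, h.star_source]
    | star_s_self e => simp [g, ← Unitization.inr_mul K, h.star_s_self]
    | star_s_ne e f hef => simp [g, ← Unitization.inr_mul K, h.star_s_ne e f hef]
    | regular v hne hfin =>
      simp only [map_sum, map_mul, FreeAlgebra.lift_ι_apply, g, h.regular v hne hfin,
        ← Unitization.inr_mul K]
      exact map_sum (Unitization.inrNonUnitalAlgHom K R) _ _
  let F : UnitalEnvelope K G →ₐ[K] Unitization K R :=
    RingQuot.liftAlgHom K ⟨FreeAlgebra.lift K g, hg⟩
  have hF : ∀ x, F (envelopeGen K G x) = g x := fun x => by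
    simp only [F, envelopeGen, RingQuot.liftAlgHom_mkAlgHom_apply, FreeAlgebra.lift_ι_apply]
  have hfst : ∀ x : LeavittPathAlgebra K G, (F x.1).fst = 0 := by
    rintro ⟨x, hx⟩
    induction hx using NonUnitalAlgebra.adjoin_induction with
    | mem x hx => obtain ⟨y, rfl⟩ := hx; simp [hF, g]
    | add x y _ _ hx hy => simp_all
    | zero => simp
    | mul x y _ _ hx hy => simp_all
    | smul r x _ hx => simp_all
  refine ⟨{ toFun := fun x => (F x.1).snd
            map_smul' := fun k x => by simp
            map_zero' := by simp
            map_add' := fun x y => by simp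
            map_mul' := fun x y => by simp [hfst] }, ⟨fun A => ?_, fun e => ?_, fun e => ?_⟩, ?_⟩
  · exact congrArg (fun z : Unitization K R => z.snd) (hF (.p A))
  · exact congrArg (fun z : Unitization K R => z.snd) (hF (.s e))
  · exact congrArg (fun z : Unitization K R => z.snd) (hF (.sStar e))
  · rintro ψ ⟨h1, h2, h3⟩
    ext ⟨x, hx⟩
    induction hx using NonUnitalAlgebra.adjoin_induction with
    | mem x hx =>
      obtain ⟨y, rfl⟩ := hx
      refine Eq.trans ?_ (congrArg (fun z : Unitization K R => z.snd) (hF y)).symm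
      cases y with
      | p A => exact h1 A
      | s e => exact h2 e
      | sStar e => exact h3 e
    | add x y hx hy ihx ihy =>
      exact (map_add ψ ⟨x, hx⟩ ⟨y, hy⟩).trans ((congrArg₂ (· + ·) ihx ihy).trans
        (by simp))
    | zero => exact (map_zero ψ).trans (map_zero _).symm
    | mul x y hx hy ihx ihy =>
      exact (map_mul ψ ⟨x, hx⟩ ⟨y, hy⟩).trans ((congrArg₂ (· * ·) ihx ihy).trans
        (map_mul _ (⟨x, hx⟩ : LeavittPathAlgebra K G) ⟨y, hy⟩).symm)
    | smul r x hx ihx =>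
      exact (map_smul ψ r ⟨x, hx⟩).trans ((congrArg (r • ·) ihx).trans (by simp))

end Algebra

section Grading

variable (K : Type u) [Field K] (G : Ultragraph V E)

/-- Finite paths: generalized vertices (length `0`), and nonempty sequences `e :: l` of edges in
which the source of each edge lies in the range of the preceding one. -/
inductive FinitePath (G : Ultragraph V E) : Type (max v w)
  | vertex (A : G.GeneralizedVertex) : FinitePath G
  | edges (e : E) (l : List E)
      (chain : List.IsChain (fun a b => G.source b ∈ G.range a) (e :: l)) : FinitePath G

variable {G} in
/-- The length of a finite path. -/
def FinitePath.length : G.FinitePath → ℕ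
  | .vertex _ => 0
  | .edges _ l _ => l.length + 1

/-- The product `s_e s_{f_1} ⋯ s_{f_k}` for the sequence `e, f_1, …, f_k`. -/
def sWord : E → List E → LeavittPathAlgebra K G
  | e, [] => s K G e
  | e, f :: l => s K G e * sWord f l

/-- The product `s_{f_k}^* ⋯ s_{f_1}^* s_e^*` for the sequence `e, f_1, …, f_k`. -/
def starWord : E → List E → LeavittPathAlgebra K G
  | e, [] => sStar K G e
  | e, f :: l => starWord f l * sStar K G e

variable {G} in
/-- The element `s_α`, with `s_A = p_A` for a generalized vertex `A`. -/
def sPath : G.FinitePath → LeavittPathAlgebra K G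
  | .vertex A => p K A
  | .edges e l _ => sWord K G e l

variable {G} in
/-- The element `s_α^*`, with `s_A^* = p_A` for a generalized vertex `A`. -/
def starPath : G.FinitePath → LeavittPathAlgebra K G
  | .vertex A => p K A
  | .edges e l _ => starWord K G e l

/-- The degree-`n` component of `L_K(G)`: the span of all `s_α p_A s_β^*` with `|α| - |β| = n`. -/
def homogeneousPart (n : ℤ) : Submodule K (LeavittPathAlgebra K G) :=
  Submodule.span K {x | ∃ (α β : G.FinitePath) (A : G.GeneralizedVertex),
    (α.length : ℤ) - (β.length : ℤ) = n ∧ x = sPath K α * p K A * starPath K β}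

variable {K G}

/-- A two-sided ideal `I` is graded if `I = ⨁ₙ (I ∩ L_K(G)ₙ)`: every element of `I` is a finite
sum of homogeneous elements that lie in `I`. -/
def IsGradedIdeal (I : TwoSidedIdeal (LeavittPathAlgebra K G)) : Prop :=
  ∀ x ∈ I, ∃ f : ℤ →₀ LeavittPathAlgebra K G,
    (∀ n, f n ∈ I ∧ f n ∈ homogeneousPart K G n) ∧ x = f.sum fun _ y => y

end Grading

section Ideals

variable (K : Type u) [Field K] (G : Ultragraph V E)

variable {G} in
/-- The element `p_A - ∑_{e ∈ S} s_e s_e^*`. -/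
def gapElement (A : G.GeneralizedVertex) (S : Finset E) : LeavittPathAlgebra K G :=
  p K A - ∑ e ∈ S, s K G e * sStar K G e

/-- All elements `p_A - ∑_{e ∈ S} s_e s_e^*` with `A` a generalized vertex and `S` a finite set of
edges having a common source `v ∈ A`. -/
def gapElements : Set (LeavittPathAlgebra K G) :=
  {x | ∃ (A : G.GeneralizedVertex) (S : Finset E),
    (∃ v ∈ A.1, ∀ e ∈ S, G.source e = v) ∧ x = gapElement K A S}

/-- The edges `e` with source `v` and `r(e) ∉ H`. -/
def emittedOutside (H : Set G.GeneralizedVertex) (v : V) : Set E :=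
  {e | e ∈ G.emitted v ∧ GeneralizedVertex.ofRange G e ∉ H}

/-- The set `B_H` of breaking vertices of `H`. -/
def breakingVertices (H : Set G.GeneralizedVertex) : Set V :=
  {v | (G.emitted v).Infinite ∧ (G.emittedOutside H v).Nonempty ∧ (G.emittedOutside H v).Finite}

variable {G} in
/-- The element `p_v^H = p_v - ∑_{s(e) = v, r(e) ∉ H} s_e s_e^*` for a breaking vertex `v`. -/
noncomputable def breakingElement (H : Set G.GeneralizedVertex) (v : V)
    (hv : v ∈ G.breakingVertices H) : LeavittPathAlgebra K G :=
  gapElement K (GeneralizedVertex.single G v) hv.2.2.toFinset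

variable {K G}

/-- The set `H_I` of generalized vertices `A` with `p_A ∈ I`. -/
def vertexSet (I : TwoSidedIdeal (LeavittPathAlgebra K G)) : Set G.GeneralizedVertex :=
  {A | p K A ∈ I}

/-- The set `S_I` of breaking vertices `v` of `H_I` with `p_v^{H_I} ∈ I`. -/
def breakingSet (I : TwoSidedIdeal (LeavittPathAlgebra K G)) : Set V :=
  {v | ∃ hv : v ∈ G.breakingVertices (vertexSet I), breakingElement K (vertexSet I) v hv ∈ I}

/-- The set `{p_A | A ∈ H_I} ∪ {p_v^{H_I} | v ∈ S_I}`. -/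
def canonicalGenerators (I : TwoSidedIdeal (LeavittPathAlgebra K G)) :
    Set (LeavittPathAlgebra K G) :=
  {x | ∃ A ∈ vertexSet I, x = p K A} ∪
    {x | ∃ v ∈ breakingSet I, ∃ hv : v ∈ G.breakingVertices (vertexSet I),
      x = breakingElement K (vertexSet I) v hv}

end Ideals

end Ultragraph

namespace Ultragraph

universe u v w

variable {V : Type v} {E : Type w} {G : Ultragraph V E}

/-! The substance is (1) ⇒ (3). Let `J` be the ideal generated by the canonical generators of `I`;
clearly `J ≤ I`. Since `I` is graded, it suffices that each homogeneous `z ∈ I` lies in `J`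
(`mem_of_mem_wordSpan`). In positive degree `z = q z` for some `q = ∑ s_e s_e^*` over a finite set
of edges, so `z` is recovered from the elements `s_e^* z ∈ I` of smaller degree; negative degree is
symmetric.

Degree zero is filtered by word length (`degreeZeroPart`). Modulo a combination `y` of projections
`p_A`, an element `z` of level `N + 1` is fixed by some `q` on both sides, and then `z = q z q + (y
- y q)`. The corner `q z q` is built from the elements `s_e^* z s_f ∈ I` of level `N`. The remainder
`y - y q` is a combination of elements `p_A - p_A q`. Refining the sets `A` until they are disjoint
isolates the terms, and each one with nonzero coefficient lies in `I` (`sum_gap_mem`). Only finitely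
many sources occur in `q`, so `p_A - p_A q` splits into a projection `p_B` and pieces `p_v - ∑_{e ∈
S} s_e s_e^*` (`gap_mem`). Such a piece in `I` forces `p_{r(e)} ∈ I` for every edge `e ∉ S` leaving
`v`; after discarding the edges of `S` whose range lies in `H_I`, it is a projection, a regular
vertex treated by the defining relation, or a breaking element (`single_sub_sum_mem`).

For (2) ⇒ (1), the generators are homogeneous of degree zero, and the span of the homogeneous
elements of the ideal is itself an ideal (`mul_mem_span_homogeneous`). For (3) ⇒ (2), the canonical
generators already have the required form, apart from `p_∅ = 0`. Most of the argument uses only the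
relations, so it is carried out for an arbitrary Leavitt family `b, c, d`, standing for `p, s, s^*`.
-/

/-- The relative complement of two generalized vertices. -/
def GeneralizedVertex.diff (A B : G.GeneralizedVertex) : G.GeneralizedVertex :=
  ⟨A.1 \ B.1, A.2.diff B.2⟩

/-! ### Relations in a Leavitt family and gap elements in ideals -/

namespace IsLeavittFamily

section Relations

variable {R : Type*} [NonUnitalRing R] {b : G.GeneralizedVertex → R} {c d : E → R}

theorem b_eq_zero (h : G.IsLeavittFamily b c d) {A : G.GeneralizedVertex} (hA : A.1 = ∅) :
    b A = 0 := by
  have : A = GeneralizedVertex.empty G := Subtype.ext hA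
  rw [this, h.p_empty]

theorem b_mul_b_of_subset (h : G.IsLeavittFamily b c d) {A B : G.GeneralizedVertex}
    (hAB : A.1 ⊆ B.1) : b B * b A = b A := by
  rw [h.p_inter]
  exact congrArg b (Subtype.ext (Set.inter_eq_right.2 hAB))

theorem b_mul_b_of_superset (h : G.IsLeavittFamily b c d) {A B : G.GeneralizedVertex}
    (hAB : A.1 ⊆ B.1) : b A * b B = b A := by
  rw [h.p_inter]
  exact congrArg b (Subtype.ext (Set.inter_eq_left.2 hAB))

theorem b_mul_b_of_disjoint (h : G.IsLeavittFamily b c d) {A B : G.GeneralizedVertex}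
    (hAB : A.1 ∩ B.1 = ∅) : b A * b B = 0 := by
  rw [h.p_inter]
  exact h.b_eq_zero hAB

theorem b_eq_inter_add_diff (h : G.IsLeavittFamily b c d) (A B : G.GeneralizedVertex) :
    b A = b (A.inter B) + b (A.diff B) := by
  have hU := h.p_union (A.inter B) (A.diff B)
  have h1 : (A.inter B).union (A.diff B) = A := Subtype.ext (Set.inter_union_sdiff A.1 B.1)
  have h2 : b ((A.inter B).inter (A.diff B)) = 0 :=
    h.b_eq_zero (by
      ext x
      simp only [GeneralizedVertex.inter, GeneralizedVertex.diff, Set.mem_inter_iff,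
        Set.mem_sdiff, Set.mem_empty_iff_false, iff_false]
      tauto)
  rwa [h1, h2, sub_zero] at hU

theorem b_mul_c_of_mem (h : G.IsLeavittFamily b c d) {A : G.GeneralizedVertex} {e : E}
    (he : G.source e ∈ A.1) : b A * c e = c e := by
  rw [← h.source_s e, ← mul_assoc, h.b_mul_b_of_subset]
  simpa [GeneralizedVertex.single] using he

theorem b_mul_c_of_notMem (h : G.IsLeavittFamily b c d) {A : G.GeneralizedVertex} {e : E}
    (he : G.source e ∉ A.1) : b A * c e = 0 := by
  rw [← h.source_s e, ← mul_assoc, h.b_mul_b_of_disjoint, zero_mul]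
  simpa [GeneralizedVertex.single] using he

theorem d_mul_b_of_mem (h : G.IsLeavittFamily b c d) {A : G.GeneralizedVertex} {e : E}
    (he : G.source e ∈ A.1) : d e * b A = d e := by
  rw [← h.star_source e, mul_assoc, h.b_mul_b_of_superset]
  simpa [GeneralizedVertex.single] using he

theorem d_mul_b_of_notMem (h : G.IsLeavittFamily b c d) {A : G.GeneralizedVertex} {e : E}
    (he : G.source e ∉ A.1) : d e * b A = 0 := by
  rw [← h.star_source e, mul_assoc, h.b_mul_b_of_disjoint, mul_zero]
  simpa [GeneralizedVertex.single] using he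

/-- An ideal of a non-unital ring need not be a `K`-subspace. A local unit repairs this: `k • x = (k
• b A) * x` is a ring multiple of `x`. -/
theorem smul_mem {K : Type*} [Field K] [Module K R] [IsScalarTower K R R]
    (hu : ∀ x : R, ∃ A, b A * x = x) (I : TwoSidedIdeal R) (k : K) {x : R} (hx : x ∈ I) :
    k • x ∈ I := by
  obtain ⟨A, hA⟩ := hu x
  rw [← hA, ← smul_mul_assoc]
  exact I.mul_mem_left _ _ hx

/-- By orthogonality only the term `f = e` survives. Thus the sum `q` over `F` is a left unit for
every word starting with an edge of `F`. -/
theorem q_mul_c (h : G.IsLeavittFamily b c d) {F : Finset E} {e : E} (he : e ∈ F) :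
    (∑ f ∈ F, c f * d f) * c e = c e := by
  rw [Finset.sum_mul, Finset.sum_eq_single_of_mem e he, mul_assoc, h.star_s_self, h.s_range]
  intro f _ hf
  rw [mul_assoc, h.star_s_ne f e hf, mul_zero]

theorem d_mul_q (h : G.IsLeavittFamily b c d) {F : Finset E} {e : E} (he : e ∈ F) :
    d e * (∑ f ∈ F, c f * d f) = d e := by
  rw [Finset.mul_sum, Finset.sum_eq_single_of_mem e he, ← mul_assoc, h.star_s_self, h.range_star]
  intro f _ hf
  rw [← mul_assoc, h.star_s_ne e f hf.symm, zero_mul]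

/-- Each `c f * d f` sits under the single vertex `s(f)`, so `b A` fixes it on both sides or kills
it on both sides. -/
theorem b_mul_q (h : G.IsLeavittFamily b c d) (F : Finset E) (A : G.GeneralizedVertex) :
    (∑ f ∈ F, c f * d f) * b A = b A * ∑ f ∈ F, c f * d f := by
  rw [Finset.sum_mul, Finset.mul_sum]
  refine Finset.sum_congr rfl fun f _ => ?_
  by_cases hf : G.source f ∈ A.1
  · rw [mul_assoc, h.d_mul_b_of_mem hf, ← mul_assoc, h.b_mul_c_of_mem hf]
  · rw [mul_assoc, h.d_mul_b_of_notMem hf, ← mul_assoc, h.b_mul_c_of_notMem hf, mul_zero,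
      zero_mul]

open Classical in
theorem b_mul_q_eq_sum_filter (h : G.IsLeavittFamily b c d) (F : Finset E)
    (A : G.GeneralizedVertex) :
    b A * ∑ f ∈ F, c f * d f = ∑ f ∈ F with G.source f ∈ A.1, c f * d f := by
  rw [Finset.mul_sum, Finset.sum_filter]
  refine Finset.sum_congr rfl fun f _ => ?_
  split_ifs with hf
  · rw [← mul_assoc, h.b_mul_c_of_mem hf]
  · rw [← mul_assoc, h.b_mul_c_of_notMem hf, zero_mul]

/-- If an ideal contains `p_v - ∑_{e ∈ S} s_e s_e^*`, then so does any ideal that contains its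
vertex projections and its breaking elements. -/
theorem single_sub_sum_mem (h : G.IsLeavittFamily b c d) {I J : TwoSidedIdeal R}
    (hvertex : ∀ A, b A ∈ I → b A ∈ J)
    (hbreak : ∀ v, (G.emitted v).Infinite → ∀ T : Finset E, T.Nonempty →
      (∀ e, e ∈ T ↔ G.source e = v ∧ b (.ofRange G e) ∉ I) →
      b (.single G v) - ∑ e ∈ T, c e * d e ∈ I → b (.single G v) - ∑ e ∈ T, c e * d e ∈ J)
    {v : V} {S : Finset E} (hS : ∀ e ∈ S, G.source e = v)
    (hI : b (.single G v) - ∑ e ∈ S, c e * d e ∈ I) :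
    b (.single G v) - ∑ e ∈ S, c e * d e ∈ J := by
  classical
  have hterm : ∀ (I' : TwoSidedIdeal R) (e : E), b (.ofRange G e) ∈ I' → c e * d e ∈ I' := by
    intro I' e he
    rw [← h.s_range e]
    exact I'.mul_mem_right _ _ (I'.mul_mem_left _ _ he)
  -- Compressing the gap element to `d e * _ * c e` kills the sum over `S` and leaves `b (r(e))`.
  have hout : ∀ e, G.source e = v → e ∉ S → b (.ofRange G e) ∈ I := by
    intro e hev heS
    have h1 := I.mul_mem_right _ (c e) (I.mul_mem_left (d e) _ hI)
    have hmem : G.source e ∈ (GeneralizedVertex.single G v).1 := hev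
    rwa [mul_sub, sub_mul, h.d_mul_b_of_mem hmem, h.star_s_self, Finset.mul_sum,
      Finset.sum_eq_zero, zero_mul, sub_zero] at h1
    intro f hf
    rw [← mul_assoc, h.star_s_ne e f (fun hef => heS (hef ▸ hf)), zero_mul]
  -- By `hout`, `T` is the set of all edges leaving `v` whose range projection is outside `I`, as in
  -- the definition of the breaking element.
  set T := S.filter fun e => b (.ofRange G e) ∉ I with hTdef
  have hT : ∀ e, e ∈ T ↔ G.source e = v ∧ b (.ofRange G e) ∉ I := by
    intro e
    rw [hTdef, Finset.mem_filter]
    constructor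
    · rintro ⟨h1, h2⟩
      exact ⟨hS e h1, h2⟩
    · rintro ⟨h1, h2⟩
      exact ⟨by_contra fun h3 => h2 (hout e h1 h3), h2⟩
  have hsplit := Finset.sum_filter_add_sum_filter_not S (fun e => b (.ofRange G e) ∉ I)
    (fun e => c e * d e)
  set D := ∑ e ∈ S with ¬ b (.ofRange G e) ∉ I, c e * d e
  have hDI : D ∈ I := sum_mem fun e he => hterm I e (not_not.1 (Finset.mem_filter.1 he).2)
  have hDJ : D ∈ J := sum_mem fun e he =>
    hterm J e (hvertex _ (not_not.1 (Finset.mem_filter.1 he).2))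
  rw [← hsplit, ← hTdef, ← sub_sub] at hI ⊢
  have hTI : b (.single G v) - ∑ e ∈ T, c e * d e ∈ I := by
    simpa using I.add_mem hI hDI
  refine J.sub_mem ?_ hDJ
  rcases T.eq_empty_or_nonempty with hTe | hTne
  · rw [hTe, Finset.sum_empty, sub_zero] at hTI ⊢
    exact hvertex _ hTI
  · by_cases hfin : (G.emitted v).Finite
    -- At a regular vertex the relation expands `b {v}`; the edges of `T` cancel, and the remaining
    -- ones have range projection in `I`, hence in `J`.
    · obtain ⟨e, he⟩ := hTne
      have hsub : T ⊆ hfin.toFinset := fun f hf => hfin.mem_toFinset.2 ((hT f).1 hf).1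
      rw [h.regular v ⟨e, ((hT e).1 he).1⟩ hfin, ← Finset.sum_sdiff hsub, add_sub_cancel_right]
      refine sum_mem fun f hf => hterm J f (hvertex _ (by_contra fun hfI => ?_))
      rw [Finset.mem_sdiff, hfin.mem_toFinset] at hf
      exact hf.2 ((hT f).2 ⟨hf.1, hfI⟩)
    · exact hbreak v hfin T hTne hT hTI

/-- Induction on a finite set `T` containing the sources in `A` of edges of `F`: cutting `A` along
`{v}` splits off a gap element at one vertex. Once no sources are left, `b A * q = 0` and only `b A`
remains. -/
theorem gap_mem (h : G.IsLeavittFamily b c d) {I J : TwoSidedIdeal R}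
    (hvertex : ∀ A, b A ∈ I → b A ∈ J)
    (hbreak : ∀ v, (G.emitted v).Infinite → ∀ T : Finset E, T.Nonempty →
      (∀ e, e ∈ T ↔ G.source e = v ∧ b (.ofRange G e) ∉ I) →
      b (.single G v) - ∑ e ∈ T, c e * d e ∈ I → b (.single G v) - ∑ e ∈ T, c e * d e ∈ J)
    (F : Finset E) (T : Finset V) (A : G.GeneralizedVertex)
    (hT : ∀ e ∈ F, G.source e ∈ A.1 → G.source e ∈ T)
    (hI : b A - b A * ∑ e ∈ F, c e * d e ∈ I) : b A - b A * ∑ e ∈ F, c e * d e ∈ J := by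
  classical
  induction T using Finset.induction_on generalizing A with
  | empty =>
    have h0 : b A * ∑ e ∈ F, c e * d e = 0 := by
      rw [h.b_mul_q_eq_sum_filter, Finset.filter_eq_empty_iff.2, Finset.sum_empty]
      intro e he heA
      simpa using hT e he heA
    rw [h0, sub_zero] at hI ⊢
    exact hvertex A hI
  | insert v T _ ih =>
    set q := ∑ e ∈ F, c e * d e with hq
    have hsplit : b A - b A * q = (b (A.inter (.single G v)) - b (A.inter (.single G v)) * q) +
        (b (A.diff (.single G v)) - b (A.diff (.single G v)) * q) := by
      rw [h.b_eq_inter_add_diff A (.single G v), add_mul]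
      abel
    have hmul : ∀ B : G.GeneralizedVertex, B.1 ⊆ A.1 → b B - b B * q ∈ I := by
      intro B hB
      have := I.mul_mem_left (b B) _ hI
      rwa [mul_sub, ← mul_assoc, h.b_mul_b_of_superset hB] at this
    rw [hsplit]
    refine J.add_mem ?_ (ih _ ?_ (hmul _ Set.sdiff_subset))
    · by_cases hv : v ∈ A.1
      · have hA : A.inter (.single G v) = .single G v :=
          Subtype.ext (Set.inter_eq_right.2 (Set.singleton_subset_iff.2 hv))
        have hI' := hmul (A.inter (.single G v)) Set.inter_subset_left
        rw [hA, hq, h.b_mul_q_eq_sum_filter] at hI' ⊢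
        exact h.single_sub_sum_mem hvertex hbreak
          (fun e he => (Finset.mem_filter.1 he).2) hI'
      · have hA : (A.inter (.single G v)).1 = ∅ := Set.inter_singleton_eq_empty.2 hv
        rw [h.b_eq_zero hA, zero_mul, sub_zero]
        exact J.zero_mem
    · rintro e he ⟨heA, hev⟩
      exact (Finset.mem_insert.1 (hT e he heA)).resolve_left hev

variable {K : Type u} [Field K] [Module K R] [IsScalarTower K R R] [SMulCommClass K R R]

/-- Cutting `C` along the first set `A` of the list shortens the list: on `C ∩ A` its coefficient
merges into `k`, and on `C \ A` its term vanishes. Both pieces stay in `I`, being left multiples.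
The separate term in `k` and `C` carries the accumulated coefficient; when the list is empty it is
inverted unless zero. -/
theorem sum_gap_mem (h : G.IsLeavittFamily b c d) (hu : ∀ x : R, ∃ A, b A * x = x)
    {I J : TwoSidedIdeal R} {q : R}
    (hgap : ∀ A, b A - b A * q ∈ I → b A - b A * q ∈ J)
    (l : List (K × G.GeneralizedVertex)) (k : K) (C : G.GeneralizedVertex)
    (hI : k • (b C - b C * q) + (l.map fun a => a.1 • (b (C.inter a.2) -
      b (C.inter a.2) * q)).sum ∈ I) :
    k • (b C - b C * q) + (l.map fun a => a.1 • (b (C.inter a.2) -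
      b (C.inter a.2) * q)).sum ∈ J := by
  induction l generalizing k C with
  | nil =>
    simp only [List.map_nil, List.sum_nil, add_zero] at hI ⊢
    rcases eq_or_ne k 0 with rfl | hk
    · rw [zero_smul]
      exact J.zero_mem
    · refine smul_mem hu J k (hgap C ?_)
      have := smul_mem hu I k⁻¹ hI
      rwa [smul_smul, inv_mul_cancel₀ hk, one_smul] at this
  | cons a l ih =>
    obtain ⟨r, A⟩ := a
    set g : G.GeneralizedVertex → R := fun A => b A - b A * q with hg
    have hgmul : ∀ B D, b B * g D = g (B.inter D) := by
      intro B D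
      simp only [hg, mul_sub, ← mul_assoc, h.p_inter]
    have hgsplit : ∀ B D, g B = g (B.inter D) + g (B.diff D) := by
      intro B D
      simp only [hg]
      rw [h.b_eq_inter_add_diff B D, add_mul]
      abel
    have hmulsum : ∀ (B : G.GeneralizedVertex), B.1 ⊆ C.1 →
        b B * (l.map fun a => a.1 • g (C.inter a.2)).sum =
          (l.map fun a => a.1 • g (B.inter a.2)).sum := by
      intro B hB
      rw [← List.sum_map_mul_left]
      refine congrArg List.sum (List.map_congr_left fun a _ => ?_)
      rw [mul_smul_comm, hgmul]
      refine congrArg (fun D => a.1 • g D) (Subtype.ext ?_)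
      change B.1 ∩ (C.1 ∩ a.2.1) = B.1 ∩ a.2.1
      rw [← Set.inter_assoc, Set.inter_eq_left.2 hB]
    have key : ∀ B : G.GeneralizedVertex, B.1 ⊆ C.1 →
        b B * (k • g C + (((r, A) :: l).map fun a => a.1 • g (C.inter a.2)).sum) =
          k • g B + r • g (B.inter A) + (l.map fun a => a.1 • g (B.inter a.2)).sum := by
      intro B hB
      have e1 : B.inter C = B := Subtype.ext (Set.inter_eq_left.2 hB)
      have e2 : B.inter (C.inter A) = B.inter A := Subtype.ext (by
        change B.1 ∩ (C.1 ∩ A.1) = B.1 ∩ A.1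
        rw [← Set.inter_assoc, Set.inter_eq_left.2 hB])
      rw [List.map_cons, List.sum_cons, mul_add, mul_add, hmulsum B hB, mul_smul_comm,
        mul_smul_comm, hgmul, hgmul, e1, e2, add_assoc]
    have hI1 := I.mul_mem_left (b (C.inter A)) _ hI
    have hI2 := I.mul_mem_left (b (C.diff A)) _ hI
    have hCC : ∀ y : R, y = k • g C + (((r, A) :: l).map fun a => a.1 • g (C.inter a.2)).sum →
        y = b (C.inter A) * y + b (C.diff A) * y := by
      intro y hy
      have : b C * y = y := by
        rw [hy, key C subset_rfl, List.map_cons, List.sum_cons, add_assoc]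
      rw [← add_mul, ← h.b_eq_inter_add_diff, this]
    rw [hCC _ rfl]
    rw [key _ Set.inter_subset_left] at hI1 ⊢
    rw [key _ Set.sdiff_subset] at hI2 ⊢
    have e3 : (C.inter A).inter A = C.inter A := Subtype.ext (by
      change C.1 ∩ A.1 ∩ A.1 = C.1 ∩ A.1
      rw [Set.inter_assoc, Set.inter_self])
    have e4 : g ((C.diff A).inter A) = 0 := by
      have : b ((C.diff A).inter A) = 0 := h.b_eq_zero (Set.sdiff_inter_self)
      simp only [hg, this, zero_mul, sub_zero]
    rw [e3, ← add_smul] at hI1 ⊢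
    rw [e4, smul_zero, add_zero] at hI2 ⊢
    exact J.add_mem (ih _ _ hI1) (ih _ _ hI2)

/-- If every `b A - b A * q` in `I` lies in `J`, then so does every `y - y * q` in `I` with `y` a
combination of the `b A`. -/
theorem sub_mul_mem (h : G.IsLeavittFamily b c d) (hu : ∀ x : R, ∃ A, b A * x = x)
    {I J : TwoSidedIdeal R} {q : R}
    (hgap : ∀ A, b A - b A * q ∈ I → b A - b A * q ∈ J)
    {y : R} (hy : y ∈ Submodule.span K (Set.range b)) (hI : y - y * q ∈ I) : y - y * q ∈ J := by
  obtain ⟨C, l, hCl⟩ : ∃ (C : G.GeneralizedVertex) (l : List (K × G.GeneralizedVertex)),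
      y = (l.map fun a => a.1 • b (C.inter a.2)).sum := by
    obtain ⟨C, hC⟩ := hu y
    have : ∃ l : List (K × G.GeneralizedVertex), y = (l.map fun a => a.1 • b a.2).sum := by
      clear hI hC
      induction hy using Submodule.span_induction with
      | mem x hx =>
        obtain ⟨A, rfl⟩ := hx
        exact ⟨[(1, A)], by simp⟩
      | zero => exact ⟨[], rfl⟩
      | add x y _ _ hx hy =>
        obtain ⟨l, rfl⟩ := hx
        obtain ⟨m, rfl⟩ := hy
        exact ⟨l ++ m, by rw [List.map_append, List.sum_append]⟩
      | smul k x _ hx =>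
        obtain ⟨l, rfl⟩ := hx
        exact ⟨l.map fun a => (k * a.1, a.2), by
          simp only [List.smul_sum, List.map_map, Function.comp_def, mul_smul]⟩
    obtain ⟨l, hl⟩ := this
    -- Multiplying by a local unit `b C` of `y` places all the sets under a common `C`.
    refine ⟨C, l, ?_⟩
    conv_lhs => rw [← hC, hl, ← List.sum_map_mul_left]
    simp only [mul_smul_comm, h.p_inter]
  -- The accumulated coefficient starts at zero.
  have hexp : y - y * q = (0 : K) • (b C - b C * q) + (l.map fun a => a.1 • (b (C.inter a.2) -
      b (C.inter a.2) * q)).sum := by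
    rw [zero_smul, zero_add, hCl, ← List.sum_map_mul_right]
    clear hI hCl
    induction l with
    | nil => simp
    | cons a l ih =>
      simp only [List.map_cons, List.sum_cons]
      rw [← ih, smul_sub, smul_mul_assoc]
      abel
  rw [hexp] at hI ⊢
  exact h.sum_gap_mem hu hgap l 0 C hI

end Relations

end IsLeavittFamily
-- Words, degree spans and homogeneous elements of ideals
section Words

set_option linter.unusedSectionVars false

variable {R : Type*} [NonUnitalRing R]

/-- `IsWord b c n x`: `x` is a product `c_{e_1} ⋯ c_{e_n} b_A`. -/
inductive IsWord (b : G.GeneralizedVertex → R) (c : E → R) : ℕ → R → Prop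
  | vertex (A : G.GeneralizedVertex) : IsWord b c 0 (b A)
  | cons (e : E) {n : ℕ} {x : R} (hx : IsWord b c n x) : IsWord b c (n + 1) (c e * x)

/-- `IsStarWord b d n x`: `x` is a product `b_A d_{e_n} ⋯ d_{e_1}`. -/
inductive IsStarWord (b : G.GeneralizedVertex → R) (d : E → R) : ℕ → R → Prop
  | vertex (A : G.GeneralizedVertex) : IsStarWord b d 0 (b A)
  | snoc (e : E) {n : ℕ} {x : R} (hx : IsStarWord b d n x) : IsStarWord b d (n + 1) (x * d e)

variable {b : G.GeneralizedVertex → R} {c d : E → R}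

namespace IsLeavittFamily

/-- Lets products killed by the relations keep their length. The hypothesis `hx` supplies edges,
without which there is no word of positive length. -/
theorem isWord_zero (h : G.IsLeavittFamily b c d) {n : ℕ} {x : R} (hx : IsWord b c n x) :
    IsWord b c n 0 := by
  induction hx with
  | vertex A => rw [← h.p_empty]; exact .vertex _
  | cons e _ ih => rw [← mul_zero (c e)]; exact .cons e ih

theorem isStarWord_zero (h : G.IsLeavittFamily b c d) {n : ℕ} {x : R}
    (hx : IsStarWord b d n x) : IsStarWord b d n 0 := by
  induction hx with
  | vertex A => rw [← h.p_empty]; exact .vertex _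
  | snoc e _ ih => rw [← zero_mul (d e)]; exact .snoc e ih

theorem isWord_b_mul (h : G.IsLeavittFamily b c d) {n : ℕ} {x : R} (hx : IsWord b c n x)
    (A : G.GeneralizedVertex) : IsWord b c n (b A * x) := by
  cases hx with
  | vertex B => rw [h.p_inter]; exact .vertex _
  | cons e hx =>
    rw [← mul_assoc]
    by_cases he : G.source e ∈ A.1
    · rw [h.b_mul_c_of_mem he]; exact .cons e hx
    · rw [h.b_mul_c_of_notMem he, zero_mul]; exact h.isWord_zero (.cons e hx)

theorem isWord_mul_b (h : G.IsLeavittFamily b c d) {n : ℕ} {x : R} (hx : IsWord b c n x)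
    (A : G.GeneralizedVertex) : IsWord b c n (x * b A) := by
  induction hx with
  | vertex B => rw [h.p_inter]; exact .vertex _
  | cons e _ ih => rw [mul_assoc]; exact .cons e ih

theorem isStarWord_mul_b (h : G.IsLeavittFamily b c d) {n : ℕ} {x : R}
    (hx : IsStarWord b d n x) (A : G.GeneralizedVertex) : IsStarWord b d n (x * b A) := by
  cases hx with
  | vertex B => rw [h.p_inter]; exact .vertex _
  | snoc e hx =>
    rw [mul_assoc]
    by_cases he : G.source e ∈ A.1
    · rw [h.d_mul_b_of_mem he]; exact .snoc e hx
    · rw [h.d_mul_b_of_notMem he, mul_zero]; exact h.isStarWord_zero (.snoc e hx)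

theorem isStarWord_b_mul (h : G.IsLeavittFamily b c d) {n : ℕ} {x : R}
    (hx : IsStarWord b d n x) (A : G.GeneralizedVertex) : IsStarWord b d n (b A * x) := by
  induction hx with
  | vertex B => rw [h.p_inter]; exact .vertex _
  | snoc e _ ih => rw [← mul_assoc]; exact .snoc e ih

theorem isWord_c (h : G.IsLeavittFamily b c d) (e : E) : IsWord b c 1 (c e) := by
  rw [← h.s_range e]
  exact .cons e (.vertex _)

theorem isStarWord_d (h : G.IsLeavittFamily b c d) (e : E) : IsStarWord b d 1 (d e) := by
  rw [← h.range_star e]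
  exact .snoc e (.vertex _)

theorem isWord_d_mul (h : G.IsLeavittFamily b c d) {n : ℕ} {x : R}
    (hx : IsWord b c (n + 1) x) (e : E) : IsWord b c n (d e * x) := by
  cases hx with
  | cons f hx =>
    rw [← mul_assoc]
    by_cases hef : e = f
    · rw [hef, h.star_s_self]; exact h.isWord_b_mul hx _
    · rw [h.star_s_ne e f hef, zero_mul]; exact h.isWord_zero hx

theorem isStarWord_mul_c (h : G.IsLeavittFamily b c d) {n : ℕ} {x : R}
    (hx : IsStarWord b d (n + 1) x) (e : E) : IsStarWord b d n (x * c e) := by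
  cases hx with
  | snoc f hx =>
    rw [mul_assoc]
    by_cases hfe : f = e
    · rw [hfe, h.star_s_self]; exact h.isStarWord_mul_b hx _
    · rw [h.star_s_ne f e hfe, mul_zero]; exact h.isStarWord_zero hx

theorem isStarWord_d_mul (h : G.IsLeavittFamily b c d) {n : ℕ} {x : R}
    (hx : IsStarWord b d n x) (e : E) : IsStarWord b d (n + 1) (d e * x) := by
  induction hx with
  | vertex A => exact h.isStarWord_mul_b (h.isStarWord_d e) A
  | snoc f _ ih => rw [← mul_assoc]; exact .snoc f ih

theorem isWord_mul_c (h : G.IsLeavittFamily b c d) {n : ℕ} {x : R}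
    (hx : IsWord b c n x) (e : E) : IsWord b c (n + 1) (x * c e) := by
  induction hx with
  | vertex A => exact h.isWord_b_mul (h.isWord_c e) A
  | cons f _ ih => rw [mul_assoc]; exact .cons f ih

theorem exists_b_mul_isStarWord (h : G.IsLeavittFamily b c d) {n : ℕ} {x : R}
    (hx : IsStarWord b d n x) : ∃ A, b A * x = x := by
  induction hx with
  | vertex A => exact ⟨A, h.b_mul_b_of_subset subset_rfl⟩
  | snoc e _ ih =>
    obtain ⟨A, hA⟩ := ih
    exact ⟨A, by rw [← mul_assoc, hA]⟩

theorem exists_isWord_mul_b (h : G.IsLeavittFamily b c d) {n : ℕ} {x : R}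
    (hx : IsWord b c n x) : ∃ A, x * b A = x := by
  induction hx with
  | vertex A => exact ⟨A, h.b_mul_b_of_subset subset_rfl⟩
  | cons e _ ih =>
    obtain ⟨A, hA⟩ := ih
    exact ⟨A, by rw [mul_assoc, hA]⟩

end IsLeavittFamily

variable (K : Type u) [Field K] [Module K R]

/-- The span of the products of a word of length `m` and a star word of length `k` with
`m - k = n`. -/
def wordSpan (b : G.GeneralizedVertex → R) (c d : E → R) (n : ℤ) : Submodule K R :=
  Submodule.span K {z | ∃ (m k : ℕ) (x y : R), IsWord b c m x ∧ IsStarWord b d k y ∧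
    (m : ℤ) - k = n ∧ z = x * y}

/-- The part of degree zero spanned by the products of words of equal length at most `N`. -/
def degreeZeroPart (b : G.GeneralizedVertex → R) (c d : E → R) : ℕ → Submodule K R
  | 0 => Submodule.span K (Set.range b)
  | N + 1 => Submodule.span K (Set.range b ∪
      {z | ∃ (e f : E) (x : R), x ∈ degreeZeroPart b c d N ∧ z = c e * x * d f})

variable {K} [IsScalarTower K R R] [SMulCommClass K R R]

theorem degreeZeroPart_mono (N : ℕ) :
    degreeZeroPart K b c d N ≤ degreeZeroPart K b c d (N + 1) := by
  induction N with
  | zero => exact Submodule.span_mono Set.subset_union_left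
  | succ N ih =>
    refine Submodule.span_mono (Set.union_subset_union_right _ ?_)
    rintro z ⟨e, f, x, hx, rfl⟩
    exact ⟨e, f, x, ih hx, rfl⟩

namespace IsLeavittFamily

theorem mul_mem_degreeZeroPart (h : G.IsLeavittFamily b c d) {n : ℕ} {x y : R}
    (hx : IsWord b c n x) (hy : IsStarWord b d n y) : x * y ∈ degreeZeroPart K b c d n := by
  induction n generalizing x y with
  | zero =>
    obtain ⟨A⟩ := hx
    obtain ⟨B⟩ := hy
    rw [h.p_inter]
    exact Submodule.subset_span ⟨_, rfl⟩
  | succ n ih =>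
    cases hx with
    | cons e hx =>
      cases hy with
      | snoc f hy =>
        exact Submodule.subset_span (Or.inr ⟨e, f, _, ih hx hy, by simp only [mul_assoc]⟩)

theorem exists_mem_degreeZeroPart (h : G.IsLeavittFamily b c d) {x : R}
    (hx : x ∈ wordSpan K b c d 0) : ∃ N, x ∈ degreeZeroPart K b c d N := by
  have hmono : Monotone (degreeZeroPart K b c d) := monotone_nat_of_le_succ degreeZeroPart_mono
  have : wordSpan K b c d 0 ≤ ⨆ N, degreeZeroPart K b c d N := by
    refine Submodule.span_le.2 ?_
    rintro z ⟨m, k, x, y, hx, hy, hmk, rfl⟩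
    obtain rfl : m = k := by omega
    exact Submodule.mem_iSup_of_mem m (h.mul_mem_degreeZeroPart hx hy)
  exact (Submodule.mem_iSup_of_directed _ hmono.directed_le).1 (this hx)

theorem b_mul_mem_wordSpan (h : G.IsLeavittFamily b c d) {n : ℤ} {z : R}
    (hz : z ∈ wordSpan K b c d n) (A : G.GeneralizedVertex) : b A * z ∈ wordSpan K b c d n := by
  refine (Submodule.span_le.2 ?_ : wordSpan K b c d n ≤
    (wordSpan K b c d n).comap (LinearMap.mulLeft K (b A))) hz
  rintro _ ⟨m, k, x, y, hx, hy, hmk, rfl⟩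
  exact Submodule.subset_span ⟨m, k, _, y, h.isWord_b_mul hx A, hy, hmk,
    (mul_assoc _ _ _).symm⟩

theorem mul_b_mem_wordSpan (h : G.IsLeavittFamily b c d) {n : ℤ} {z : R}
    (hz : z ∈ wordSpan K b c d n) (A : G.GeneralizedVertex) : z * b A ∈ wordSpan K b c d n := by
  refine (Submodule.span_le.2 ?_ : wordSpan K b c d n ≤
    (wordSpan K b c d n).comap (LinearMap.mulRight K (b A))) hz
  rintro _ ⟨m, k, x, y, hx, hy, hmk, rfl⟩
  exact Submodule.subset_span ⟨m, k, x, _, hx, h.isStarWord_mul_b hy A, hmk,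
    mul_assoc _ _ _⟩

theorem c_mul_mem_wordSpan {n : ℤ} {z : R}
    (hz : z ∈ wordSpan K b c d n) (e : E) : c e * z ∈ wordSpan K b c d (n + 1) := by
  refine (Submodule.span_le.2 ?_ : wordSpan K b c d n ≤
    (wordSpan K b c d (n + 1)).comap (LinearMap.mulLeft K (c e))) hz
  rintro _ ⟨m, k, x, y, hx, hy, hmk, rfl⟩
  exact Submodule.subset_span ⟨m + 1, k, _, y, .cons e hx, hy, by push_cast; omega,
    (mul_assoc _ _ _).symm⟩

theorem mul_d_mem_wordSpan {n : ℤ} {z : R}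
    (hz : z ∈ wordSpan K b c d n) (e : E) : z * d e ∈ wordSpan K b c d (n - 1) := by
  refine (Submodule.span_le.2 ?_ : wordSpan K b c d n ≤
    (wordSpan K b c d (n - 1)).comap (LinearMap.mulRight K (d e))) hz
  rintro _ ⟨m, k, x, y, hx, hy, hmk, rfl⟩
  exact Submodule.subset_span ⟨m, k + 1, x, _, hx, .snoc e hy, by push_cast; omega,
    mul_assoc _ _ _⟩

theorem d_mul_mem_wordSpan (h : G.IsLeavittFamily b c d) {n : ℤ} {z : R}
    (hz : z ∈ wordSpan K b c d n) (e : E) : d e * z ∈ wordSpan K b c d (n - 1) := by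
  refine (Submodule.span_le.2 ?_ : wordSpan K b c d n ≤
    (wordSpan K b c d (n - 1)).comap (LinearMap.mulLeft K (d e))) hz
  rintro _ ⟨m, k, x, y, hx, hy, hmk, rfl⟩
  change d e * (x * y) ∈ wordSpan K b c d (n - 1)
  cases m with
  | zero =>
    obtain ⟨A⟩ := hx
    -- With no edge on the left to cancel, `d e` is absorbed into the star word, and a local unit `b
    -- B` serves as the left word of length zero.
    have hy' := h.isStarWord_d_mul (h.isStarWord_b_mul hy A) e
    obtain ⟨B, hB⟩ := h.exists_b_mul_isStarWord hy'
    exact Submodule.subset_span ⟨0, k + 1, b B, _, .vertex B, hy', by push_cast at hmk ⊢; omega,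
      hB.symm⟩
  | succ m =>
    exact Submodule.subset_span ⟨m, k, _, y, h.isWord_d_mul hx e, hy,
      by push_cast at hmk ⊢; omega, (mul_assoc _ _ _).symm⟩

theorem mul_c_mem_wordSpan (h : G.IsLeavittFamily b c d) {n : ℤ} {z : R}
    (hz : z ∈ wordSpan K b c d n) (e : E) : z * c e ∈ wordSpan K b c d (n + 1) := by
  refine (Submodule.span_le.2 ?_ : wordSpan K b c d n ≤
    (wordSpan K b c d (n + 1)).comap (LinearMap.mulRight K (c e))) hz
  rintro _ ⟨m, k, x, y, hx, hy, hmk, rfl⟩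
  change x * y * c e ∈ wordSpan K b c d (n + 1)
  cases k with
  | zero =>
    obtain ⟨A⟩ := hy
    have hx' := h.isWord_mul_c (h.isWord_mul_b hx A) e
    obtain ⟨B, hB⟩ := h.exists_isWord_mul_b hx'
    exact Submodule.subset_span ⟨m + 1, 0, _, b B, hx', .vertex B, by push_cast at hmk ⊢; omega,
      hB.symm⟩
  | succ k =>
    exact Submodule.subset_span ⟨m, k, x, _, hx, h.isStarWord_mul_c hy e,
      by push_cast at hmk ⊢; omega, mul_assoc _ _ _⟩

/-- In positive degree every spanning product begins with some `c e`. Allowing every larger `F'`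
makes the condition stable under sums, by taking unions. -/
theorem exists_sum_mul_eq (h : G.IsLeavittFamily b c d) {n : ℤ} (hn : 0 < n) {z : R}
    (hz : z ∈ wordSpan K b c d n) :
    ∃ F : Finset E, ∀ F', F ⊆ F' → (∑ e ∈ F', c e * d e) * z = z := by
  classical
  induction hz using Submodule.span_induction with
  | mem z hz =>
    obtain ⟨m, k, x, y, hx, hy, hmk, rfl⟩ := hz
    cases hx with
    | vertex A => omega
    | cons e hx =>
      refine ⟨{e}, fun F' hF' => ?_⟩
      rw [← mul_assoc, ← mul_assoc, h.q_mul_c (Finset.singleton_subset_iff.1 hF')]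
  | zero => exact ⟨∅, fun _ _ => mul_zero _⟩
  | add x y _ _ hx hy =>
    obtain ⟨F₁, h₁⟩ := hx
    obtain ⟨F₂, h₂⟩ := hy
    exact ⟨F₁ ∪ F₂, fun F' hF' => by
      rw [mul_add, h₁ F' (Finset.union_subset_left hF'), h₂ F' (Finset.union_subset_right hF')]⟩
  | smul r x _ hx =>
    obtain ⟨F, hF⟩ := hx
    exact ⟨F, fun F' hF' => by rw [mul_smul_comm, hF F' hF']⟩

theorem exists_mul_sum_eq (h : G.IsLeavittFamily b c d) {n : ℤ} (hn : n < 0) {z : R}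
    (hz : z ∈ wordSpan K b c d n) :
    ∃ F : Finset E, ∀ F', F ⊆ F' → z * (∑ e ∈ F', c e * d e) = z := by
  classical
  induction hz using Submodule.span_induction with
  | mem z hz =>
    obtain ⟨m, k, x, y, hx, hy, hmk, rfl⟩ := hz
    cases hy with
    | vertex A => omega
    | snoc e hy =>
      refine ⟨{e}, fun F' hF' => ?_⟩
      rw [mul_assoc, mul_assoc, h.d_mul_q (Finset.singleton_subset_iff.1 hF')]
  | zero => exact ⟨∅, fun _ _ => zero_mul _⟩
  | add x y _ _ hx hy =>
    obtain ⟨F₁, h₁⟩ := hx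
    obtain ⟨F₂, h₂⟩ := hy
    exact ⟨F₁ ∪ F₂, fun F' hF' => by
      rw [add_mul, h₁ F' (Finset.union_subset_left hF'), h₂ F' (Finset.union_subset_right hF')]⟩
  | smul r x _ hx =>
    obtain ⟨F, hF⟩ := hx
    exact ⟨F, fun F' hF' => by rw [smul_mul_assoc, hF F' hF']⟩

/-- Here `y` collects the projections in `z`; what remains is a combination of terms `c e * x * d
f`, fixed by `q` once `F` contains all their `e` and `f`. -/
theorem exists_sub_mem_of_mem_degreeZeroPart (h : G.IsLeavittFamily b c d) {N : ℕ} {z : R}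
    (hz : z ∈ degreeZeroPart K b c d (N + 1)) :
    ∃ y ∈ Submodule.span K (Set.range b), ∃ F : Finset E, ∀ F', F ⊆ F' →
      (∑ e ∈ F', c e * d e) * (z - y) = z - y ∧
        (z - y) * (∑ e ∈ F', c e * d e) = z - y := by
  classical
  induction hz using Submodule.span_induction with
  | mem z hz =>
    rcases hz with hz | ⟨e, f, x, _, rfl⟩
    · exact ⟨z, Submodule.subset_span hz, ∅, fun F' _ => by simp⟩
    · refine ⟨0, zero_mem _, {e, f}, fun F' hF' => ?_⟩
      rw [sub_zero]
      constructor
      · rw [← mul_assoc, ← mul_assoc, h.q_mul_c (hF' (by simp))]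
      · rw [mul_assoc, h.d_mul_q (hF' (by simp))]
  | zero => exact ⟨0, zero_mem _, ∅, fun F' _ => by simp⟩
  | add x₁ x₂ _ _ hx₁ hx₂ =>
    obtain ⟨y₁, hy₁, F₁, h₁⟩ := hx₁
    obtain ⟨y₂, hy₂, F₂, h₂⟩ := hx₂
    refine ⟨y₁ + y₂, add_mem hy₁ hy₂, F₁ ∪ F₂, fun F' hF' => ?_⟩
    obtain ⟨h₁l, h₁r⟩ := h₁ F' (Finset.union_subset_left hF')
    obtain ⟨h₂l, h₂r⟩ := h₂ F' (Finset.union_subset_right hF')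
    rw [add_sub_add_comm, mul_add, add_mul, h₁l, h₁r, h₂l, h₂r]
    exact ⟨rfl, rfl⟩
  | smul r x _ hx =>
    obtain ⟨y, hy, F, hF⟩ := hx
    refine ⟨r • y, Submodule.smul_mem _ r hy, F, fun F' hF' => ?_⟩
    obtain ⟨hl, hr⟩ := hF F' hF'
    rw [← smul_sub, mul_smul_comm, smul_mul_assoc, hl, hr]
    exact ⟨rfl, rfl⟩

theorem b_mem_degreeZeroPart (A : G.GeneralizedVertex) (N : ℕ) :
    b A ∈ degreeZeroPart K b c d N := by
  cases N with
  | zero => exact Submodule.subset_span ⟨A, rfl⟩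
  | succ N => exact Submodule.subset_span (Or.inl ⟨A, rfl⟩)

theorem mul_b_mem_degreeZeroPart (h : G.IsLeavittFamily b c d) {N : ℕ} {z : R}
    (hz : z ∈ degreeZeroPart K b c d N) (A : G.GeneralizedVertex) :
    z * b A ∈ degreeZeroPart K b c d N := by
  cases N with
  | zero =>
    refine (Submodule.span_le.2 ?_ : degreeZeroPart K b c d 0 ≤
      (degreeZeroPart K b c d 0).comap (LinearMap.mulRight K (b A))) hz
    rintro _ ⟨B, rfl⟩
    change b B * b A ∈ degreeZeroPart K b c d 0
    rw [h.p_inter]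
    exact b_mem_degreeZeroPart _ _
  | succ N =>
    refine (Submodule.span_le.2 ?_ : degreeZeroPart K b c d (N + 1) ≤
      (degreeZeroPart K b c d (N + 1)).comap (LinearMap.mulRight K (b A))) hz
    rintro _ (⟨B, rfl⟩ | ⟨e, f, x, hx, rfl⟩)
    · change b B * b A ∈ degreeZeroPart K b c d (N + 1)
      rw [h.p_inter]
      exact b_mem_degreeZeroPart _ _
    · change c e * x * d f * b A ∈ degreeZeroPart K b c d (N + 1)
      rw [mul_assoc]
      by_cases hf : G.source f ∈ A.1
      · rw [h.d_mul_b_of_mem hf]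
        exact Submodule.subset_span (Or.inr ⟨e, f, x, hx, rfl⟩)
      · rw [h.d_mul_b_of_notMem hf, mul_zero]
        exact zero_mem _

theorem b_mul_mem_degreeZeroPart (h : G.IsLeavittFamily b c d) {N : ℕ} {z : R}
    (hz : z ∈ degreeZeroPart K b c d N) (A : G.GeneralizedVertex) :
    b A * z ∈ degreeZeroPart K b c d N := by
  cases N with
  | zero =>
    refine (Submodule.span_le.2 ?_ : degreeZeroPart K b c d 0 ≤
      (degreeZeroPart K b c d 0).comap (LinearMap.mulLeft K (b A))) hz
    rintro _ ⟨B, rfl⟩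
    change b A * b B ∈ degreeZeroPart K b c d 0
    rw [h.p_inter]
    exact b_mem_degreeZeroPart _ _
  | succ N =>
    refine (Submodule.span_le.2 ?_ : degreeZeroPart K b c d (N + 1) ≤
      (degreeZeroPart K b c d (N + 1)).comap (LinearMap.mulLeft K (b A))) hz
    rintro _ (⟨B, rfl⟩ | ⟨e, f, x, hx, rfl⟩)
    · change b A * b B ∈ degreeZeroPart K b c d (N + 1)
      rw [h.p_inter]
      exact b_mem_degreeZeroPart _ _
    · change b A * (c e * x * d f) ∈ degreeZeroPart K b c d (N + 1)
      rw [mul_assoc, ← mul_assoc]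
      by_cases he : G.source e ∈ A.1
      · rw [h.b_mul_c_of_mem he]
        exact Submodule.subset_span (Or.inr ⟨e, f, x, hx, by rw [mul_assoc]⟩)
      · rw [h.b_mul_c_of_notMem he, zero_mul]
        exact zero_mem _

theorem d_mul_mul_c_mem_degreeZeroPart (h : G.IsLeavittFamily b c d) {N : ℕ} {z : R}
    (hz : z ∈ degreeZeroPart K b c d (N + 1)) (e f : E) :
    d e * z * c f ∈ degreeZeroPart K b c d N := by
  refine (Submodule.span_le.2 ?_ : degreeZeroPart K b c d (N + 1) ≤
    (degreeZeroPart K b c d N).comap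
      ((LinearMap.mulRight K (c f)).comp (LinearMap.mulLeft K (d e)))) hz
  rintro _ (⟨A, rfl⟩ | ⟨e', f', x, hx, rfl⟩)
  · change d e * b A * c f ∈ degreeZeroPart K b c d N
    by_cases he : G.source e ∈ A.1
    · rw [h.d_mul_b_of_mem he]
      by_cases hef : e = f
      · rw [hef, h.star_s_self]
        exact b_mem_degreeZeroPart _ _
      · rw [h.star_s_ne e f hef]
        exact zero_mem _
    · rw [h.d_mul_b_of_notMem he, zero_mul]
      exact zero_mem _
  · change d e * (c e' * x * d f') * c f ∈ degreeZeroPart K b c d N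
    have hassoc : d e * (c e' * x * d f') * c f = (d e * c e') * x * (d f' * c f) := by
      simp only [mul_assoc]
    rw [hassoc]
    by_cases hee : e = e'
    · by_cases hff : f' = f
      · rw [hee, hff, h.star_s_self, h.star_s_self]
        exact h.mul_b_mem_degreeZeroPart (h.b_mul_mem_degreeZeroPart hx _) _
      · rw [h.star_s_ne f' f hff, mul_zero]
        exact zero_mem _
    · rw [h.star_s_ne e e' hee, zero_mul, zero_mul]
      exact zero_mem _

/-- Induction on the level: the corner `q z q` drops one level after compression by `d e` and `c f`,
and the rest of `z` is `y - y * q`, covered by `sub_mul_mem`. -/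
theorem mem_of_mem_degreeZeroPart (h : G.IsLeavittFamily b c d)
    (hu : ∀ x : R, ∃ A, b A * x = x) {I J : TwoSidedIdeal R}
    (hgap : ∀ (F : Finset E) (A : G.GeneralizedVertex),
      b A - b A * ∑ e ∈ F, c e * d e ∈ I → b A - b A * ∑ e ∈ F, c e * d e ∈ J)
    {N : ℕ} {z : R} (hz : z ∈ degreeZeroPart K b c d N) (hI : z ∈ I) : z ∈ J := by
  induction N generalizing z with
  | zero =>
    -- Level zero is the case `q = 0`, with no edges.
    have h0 : ∀ y : R, y - y * ∑ e ∈ (∅ : Finset E), c e * d e = y := by simp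
    have := h.sub_mul_mem hu (hgap ∅) hz
    rw [h0] at this
    exact this hI
  | succ N ih =>
    obtain ⟨y, hy, F, hF⟩ := h.exists_sub_mem_of_mem_degreeZeroPart hz
    obtain ⟨hl, hr⟩ := hF F subset_rfl
    have hqy : (∑ e ∈ F, c e * d e) * y = y * ∑ e ∈ F, c e * d e := by
      clear hl hr hF
      induction hy using Submodule.span_induction with
      | mem x hx =>
        obtain ⟨A, rfl⟩ := hx
        exact h.b_mul_q F A
      | zero => rw [zero_mul, mul_zero]
      | add x y _ _ hx hy => rw [mul_add, add_mul, hx, hy]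
      | smul k x _ hx => rw [mul_smul_comm, smul_mul_assoc, hx]
    have hqq : (∑ e ∈ F, c e * d e) * (∑ e ∈ F, c e * d e) = ∑ e ∈ F, c e * d e := by
      conv_lhs => rw [Finset.mul_sum]
      refine Finset.sum_congr rfl fun e he => ?_
      rw [← mul_assoc, h.q_mul_c he]
    have hcorner : (∑ e ∈ F, c e * d e) * z * (∑ e ∈ F, c e * d e) ∈ J := by
      rw [Finset.sum_mul, Finset.sum_mul]
      refine sum_mem fun e _ => ?_
      rw [Finset.mul_sum]
      refine sum_mem fun f _ => ?_
      have hassoc : c e * d e * z * (c f * d f) = c e * (d e * z * c f) * d f := by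
        simp only [mul_assoc]
      rw [hassoc]
      exact J.mul_mem_right _ _ (J.mul_mem_left _ _
        (ih (h.d_mul_mul_c_mem_degreeZeroPart hz e f)
          (I.mul_mem_right _ _ (I.mul_mem_left _ _ hI))))
    set q := ∑ e ∈ F, c e * d e
    -- Here `z - y` is fixed by `q` on both sides, while `q` is idempotent and commutes with `y`.
    have hdiff : z - q * z * q = y - y * q := by
      have h1 : q * z * q = z - y + y * q := by
        have h2 : q * z = (z - y) + y * q := by rw [← hqy, ← hl, ← mul_add, sub_add_cancel]
        rw [h2, add_mul, hr, mul_assoc, hqq]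
      rw [h1]
      abel
    have hyI : y - y * q ∈ I := by
      rw [← hdiff]
      exact I.sub_mem hI (I.mul_mem_right _ _ (I.mul_mem_left _ _ hI))
    have hyJ := h.sub_mul_mem hu (hgap F) hy hyI
    rw [← hdiff] at hyJ
    simpa using J.add_mem hyJ hcorner

theorem mem_of_mem_wordSpan (h : G.IsLeavittFamily b c d)
    (hu : ∀ x : R, ∃ A, b A * x = x) {I J : TwoSidedIdeal R}
    (hgap : ∀ (F : Finset E) (A : G.GeneralizedVertex),
      b A - b A * ∑ e ∈ F, c e * d e ∈ I → b A - b A * ∑ e ∈ F, c e * d e ∈ J)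
    {n : ℤ} {z : R} (hz : z ∈ wordSpan K b c d n) (hI : z ∈ I) : z ∈ J := by
  induction n using Int.induction_on generalizing z with
  | zero =>
    obtain ⟨N, hN⟩ := h.exists_mem_degreeZeroPart hz
    exact h.mem_of_mem_degreeZeroPart hu hgap hN hI
  | succ n ih =>
    obtain ⟨F, hF⟩ := h.exists_sum_mul_eq (by omega) hz
    rw [← hF F subset_rfl, Finset.sum_mul]
    refine sum_mem fun e _ => ?_
    rw [mul_assoc]
    refine J.mul_mem_left _ _ (ih ?_ (I.mul_mem_left _ _ hI))
    simpa using h.d_mul_mem_wordSpan hz e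
  | pred n ih =>
    obtain ⟨F, hF⟩ := h.exists_mul_sum_eq (by omega) hz
    rw [← hF F subset_rfl, Finset.mul_sum]
    refine sum_mem fun e _ => ?_
    rw [← mul_assoc]
    refine J.mul_mem_right _ _ (ih ?_ (I.mul_mem_right _ _ hI))
    simpa using h.mul_c_mem_wordSpan hz e

end IsLeavittFamily

end Words

/-! ### Local units and ideals generated in degree zero -/

namespace IsLeavittFamily

section Generated

set_option linter.unusedSectionVars false

variable {K : Type u} [Field K] {R : Type*} [NonUnitalRing R] [Module K R] [IsScalarTower K R R]
  [SMulCommClass K R R] {b : G.GeneralizedVertex → R} {c d : E → R}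

theorem exists_b_mul_eq (h : G.IsLeavittFamily b c d)
    (hgen : NonUnitalAlgebra.adjoin K (Set.range b ∪ Set.range c ∪ Set.range d) = ⊤) (x : R) :
    ∃ A, b A * x = x := by
  have hx : x ∈ NonUnitalAlgebra.adjoin K (Set.range b ∪ Set.range c ∪ Set.range d) := by
    rw [hgen]; trivial
  induction hx using NonUnitalAlgebra.adjoin_induction with
  | mem x hx =>
    rcases hx with (⟨A, rfl⟩ | ⟨e, rfl⟩) | ⟨e, rfl⟩
    · exact ⟨A, h.b_mul_b_of_subset subset_rfl⟩
    · exact ⟨.single G (G.source e), h.source_s e⟩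
    · exact ⟨.ofRange G e, h.range_star e⟩
  | zero => exact ⟨.empty G, mul_zero _⟩
  | add x y _ _ hx hy =>
    obtain ⟨A, hA⟩ := hx
    obtain ⟨B, hB⟩ := hy
    refine ⟨A.union B, ?_⟩
    rw [← hA, ← hB, mul_add, ← mul_assoc, ← mul_assoc,
      h.b_mul_b_of_subset (A := A) (B := A.union B) Set.subset_union_left,
      h.b_mul_b_of_subset (A := B) (B := A.union B) Set.subset_union_right]
  | mul x y _ _ hx _ =>
    obtain ⟨A, hA⟩ := hx
    exact ⟨A, by rw [← mul_assoc, hA]⟩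
  | smul k x _ hx =>
    obtain ⟨A, hA⟩ := hx
    exact ⟨A, by rw [mul_smul_comm, hA]⟩

/-- The elements of an ideal that are sums of homogeneous elements of the ideal are closed under
multiplication from both sides. -/
theorem mul_mem_span_homogeneous (h : G.IsLeavittFamily b c d)
    (hgen : NonUnitalAlgebra.adjoin K (Set.range b ∪ Set.range c ∪ Set.range d) = ⊤)
    (I : TwoSidedIdeal R) (r : R) :
    ∀ x ∈ Submodule.span K {x | x ∈ I ∧ ∃ n, x ∈ wordSpan K b c d n},
      r * x ∈ Submodule.span K {x | x ∈ I ∧ ∃ n, x ∈ wordSpan K b c d n} ∧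
      x * r ∈ Submodule.span K {x | x ∈ I ∧ ∃ n, x ∈ wordSpan K b c d n} := by
  set C := Submodule.span K {x | x ∈ I ∧ ∃ n, x ∈ wordSpan K b c d n} with hC
  -- It suffices that `r` sends homogeneous elements to homogeneous ones; the generators do so by
  -- shifting the degree.
  have key : ∀ r : R, (∀ n, ∀ x ∈ wordSpan K b c d n, ∃ m, r * x ∈ wordSpan K b c d m) →
      (∀ n, ∀ x ∈ wordSpan K b c d n, ∃ m, x * r ∈ wordSpan K b c d m) →
      ∀ x ∈ C, r * x ∈ C ∧ x * r ∈ C := by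
    intro r hl hr x hx
    constructor
    · refine (Submodule.span_le.2 ?_ : C ≤ C.comap (LinearMap.mulLeft K r)) hx
      rintro y ⟨hyI, n, hy⟩
      exact Submodule.subset_span ⟨I.mul_mem_left _ _ hyI, hl n y hy⟩
    · refine (Submodule.span_le.2 ?_ : C ≤ C.comap (LinearMap.mulRight K r)) hx
      rintro y ⟨hyI, n, hy⟩
      exact Submodule.subset_span ⟨I.mul_mem_right _ _ hyI, hr n y hy⟩
  have hr : r ∈ NonUnitalAlgebra.adjoin K (Set.range b ∪ Set.range c ∪ Set.range d) := by
    rw [hgen]; trivial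
  induction hr using NonUnitalAlgebra.adjoin_induction with
  | mem r hr =>
    rcases hr with (⟨A, rfl⟩ | ⟨e, rfl⟩) | ⟨e, rfl⟩
    · exact key _ (fun n x hx => ⟨n, h.b_mul_mem_wordSpan hx A⟩)
        (fun n x hx => ⟨n, h.mul_b_mem_wordSpan hx A⟩)
    · exact key _ (fun n x hx => ⟨_, c_mul_mem_wordSpan hx e⟩)
        (fun n x hx => ⟨_, h.mul_c_mem_wordSpan hx e⟩)
    · exact key _ (fun n x hx => ⟨_, h.d_mul_mem_wordSpan hx e⟩)
        (fun n x hx => ⟨_, mul_d_mem_wordSpan hx e⟩)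
  | zero => exact fun x _ => by simp
  | add r t _ _ hr ht =>
    intro x hx
    rw [add_mul, mul_add]
    exact ⟨add_mem (hr x hx).1 (ht x hx).1, add_mem (hr x hx).2 (ht x hx).2⟩
  | mul r t _ _ hr ht =>
    intro x hx
    rw [mul_assoc r t x, ← mul_assoc x r t]
    exact ⟨(hr _ (ht x hx).1).1, (ht _ (hr x hx).2).2⟩
  | smul k r _ hr =>
    intro x hx
    rw [smul_mul_assoc, mul_smul_comm]
    exact ⟨C.smul_mem k (hr x hx).1, C.smul_mem k (hr x hx).2⟩

theorem span_le_span_homogeneous (h : G.IsLeavittFamily b c d)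
    (hgen : NonUnitalAlgebra.adjoin K (Set.range b ∪ Set.range c ∪ Set.range d) = ⊤)
    {T : Set R} (hT : T ⊆ wordSpan K b c d 0) {x : R} (hx : x ∈ TwoSidedIdeal.span T) :
    x ∈ Submodule.span K {x | x ∈ TwoSidedIdeal.span T ∧ ∃ n, x ∈ wordSpan K b c d n} := by
  set C := Submodule.span K {x | x ∈ TwoSidedIdeal.span T ∧ ∃ n, x ∈ wordSpan K b c d n} with hC
  -- `C` is an ideal containing `T`, so the ideal generated by `T` lies in it.
  let I' : TwoSidedIdeal R := .mk' C C.zero_mem C.add_mem C.neg_mem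
    (fun {r y} hy => (h.mul_mem_span_homogeneous hgen _ r y hy).1)
    (fun {y r} hy => (h.mul_mem_span_homogeneous hgen _ r y hy).2)
  have hI' : ∀ y, y ∈ I' ↔ y ∈ C := fun y => TwoSidedIdeal.mem_mk' _ _ _ _ _ _ y
  refine (hI' x).1 (TwoSidedIdeal.mem_span_iff.1 hx I' fun t ht => (hI' t).2 ?_)
  exact Submodule.subset_span ⟨TwoSidedIdeal.subset_span ht, 0, hT ht⟩

theorem exists_finsupp_of_mem_span (hu : ∀ x : R, ∃ A, b A * x = x) (I : TwoSidedIdeal R)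
    {x : R} (hx : x ∈ Submodule.span K {x | x ∈ I ∧ ∃ n, x ∈ wordSpan K b c d n}) :
    ∃ f : ℤ →₀ R, (∀ n, f n ∈ I ∧ f n ∈ wordSpan K b c d n) ∧ x = f.sum fun _ y => y := by
  classical
  induction hx using Submodule.span_induction with
  | mem x hx =>
    obtain ⟨hxI, n, hxn⟩ := hx
    refine ⟨Finsupp.single n x, fun m => ?_, (Finsupp.sum_single_index (h := fun _ y => y) rfl).symm⟩
    rw [Finsupp.single_apply]
    split_ifs with hnm
    · exact ⟨hxI, hnm ▸ hxn⟩
    · exact ⟨I.zero_mem, zero_mem _⟩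
  | zero => exact ⟨0, fun n => ⟨I.zero_mem, zero_mem _⟩, Finsupp.sum_zero_index.symm⟩
  | add x y _ _ hx hy =>
    obtain ⟨f, hf, rfl⟩ := hx
    obtain ⟨g, hg, rfl⟩ := hy
    exact ⟨f + g, fun n => ⟨I.add_mem (hf n).1 (hg n).1, add_mem (hf n).2 (hg n).2⟩,
      (Finsupp.sum_add_index' (fun _ => rfl) fun _ _ _ => rfl).symm⟩
  | smul k x _ hx =>
    obtain ⟨f, hf, rfl⟩ := hx
    refine ⟨f.mapRange (k • ·) (smul_zero k), fun n => ?_, ?_⟩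
    · rw [Finsupp.mapRange_apply]
      exact ⟨smul_mem hu I k (hf n).1, Submodule.smul_mem _ k (hf n).2⟩
    · rw [Finsupp.sum_mapRange_index (fun _ => rfl), Finsupp.smul_sum]

theorem gap_mem_wordSpan (h : G.IsLeavittFamily b c d) (A : G.GeneralizedVertex)
    (S : Finset E) : b A - ∑ e ∈ S, c e * d e ∈ wordSpan K b c d 0 := by
  refine sub_mem (Submodule.subset_span ⟨0, 0, b A, b A, .vertex A, .vertex A, rfl,
    (h.b_mul_b_of_subset subset_rfl).symm⟩) (sum_mem fun e _ => ?_)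
  exact Submodule.subset_span ⟨1, 1, _, _, h.isWord_c e, h.isStarWord_d e, rfl, rfl⟩

end Generated

end IsLeavittFamily

/-! ### Comparison of words with finite paths -/

section Paths

variable {K : Type u} [Field K]

theorem adjoin_generators_eq_top : NonUnitalAlgebra.adjoin K
    (Set.range (p K) ∪ Set.range (s K G) ∪ Set.range (sStar K G)) = ⊤ := by
  rw [eq_top_iff]
  rintro ⟨x, hx⟩ -
  induction hx using NonUnitalAlgebra.adjoin_induction with
  | mem x hx =>
    obtain ⟨y, rfl⟩ := hx
    apply NonUnitalAlgebra.subset_adjoin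
    cases y with
    | p A => exact .inl (.inl ⟨A, rfl⟩)
    | s e => exact .inl (.inr ⟨e, rfl⟩)
    | sStar e => exact .inr ⟨e, rfl⟩
  | add x y hx hy ihx ihy => exact add_mem ihx ihy
  | zero => exact zero_mem _
  | mul x y hx hy ihx ihy => exact mul_mem ihx ihy
  | smul r x hx ih => exact SMulMemClass.smul_mem r ih

theorem isWord_sWord (e : E) (l : List E) :
    IsWord (p K) (s K G) (l.length + 1) (sWord K G e l) := by
  induction l generalizing e with
  | nil => exact (isLeavittFamily_gen K G).isWord_c e
  | cons f l ih => exact .cons e (ih f)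

theorem isStarWord_starWord (e : E) (l : List E) :
    IsStarWord (p K) (sStar K G) (l.length + 1) (starWord K G e l) := by
  induction l generalizing e with
  | nil => exact (isLeavittFamily_gen K G).isStarWord_d e
  | cons f l ih => exact .snoc e (ih f)

theorem isWord_sPath (α : G.FinitePath) : IsWord (p K) (s K G) α.length (sPath K α) := by
  cases α with
  | vertex A => exact .vertex A
  | edges e l _ => exact isWord_sWord e l

theorem isStarWord_starPath (α : G.FinitePath) :
    IsStarWord (p K) (sStar K G) α.length (starPath K α) := by
  cases α with
  | vertex A => exact .vertex A
  | edges e l _ => exact isStarWord_starWord e l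

theorem p_mul_sWord {A : G.GeneralizedVertex} {e : E} (he : G.source e ∉ A.1) (l : List E) :
    p K A * sWord K G e l = 0 := by
  cases l with
  | nil => exact (isLeavittFamily_gen K G).b_mul_c_of_notMem he
  | cons f l => rw [sWord, ← mul_assoc, (isLeavittFamily_gen K G).b_mul_c_of_notMem he, zero_mul]

theorem starWord_mul_p {A : G.GeneralizedVertex} {e : E} (he : G.source e ∉ A.1) (l : List E) :
    starWord K G e l * p K A = 0 := by
  cases l with
  | nil => exact (isLeavittFamily_gen K G).d_mul_b_of_notMem he
  | cons f l =>
    rw [starWord, mul_assoc, (isLeavittFamily_gen K G).d_mul_b_of_notMem he, mul_zero]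

/-- Words carry no path condition, but nothing is gained: if `s(f) ∉ r(e)`, then `s_e s_f = s_e
p_{r(e)} s_f = 0`. -/
theorem IsWord.exists_sPath {n : ℕ} {x : LeavittPathAlgebra K G}
    (hx : IsWord (p K) (s K G) n x) :
    x = 0 ∨ ∃ (α : G.FinitePath) (A : G.GeneralizedVertex), α.length = n ∧
      x = sPath K α * p K A := by
  have h := isLeavittFamily_gen K G
  induction hx with
  | vertex A => exact .inr ⟨.vertex A, A, rfl, (h.b_mul_b_of_subset subset_rfl).symm⟩
  | cons e _ ih =>
    rcases ih with rfl | ⟨α, A, rfl, rfl⟩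
    · exact .inl (mul_zero _)
    · cases α with
      | vertex B =>
        refine .inr ⟨.edges e [] (List.isChain_singleton e), B.inter A, rfl, ?_⟩
        exact congrArg (s K G e * ·) (h.p_inter B A)
      | edges f l hl =>
        by_cases hf : G.source f ∈ G.range e
        · exact .inr ⟨.edges e (f :: l) (List.isChain_cons_cons.2 ⟨hf, hl⟩), A, rfl,
            (mul_assoc (s K G e) (sWord K G f l) (p K A)).symm⟩
        · left
          change s K G e * (sWord K G f l * p K A) = 0
          rw [← h.s_range e, mul_assoc, ← mul_assoc (p K _) (sWord K G f l),
            p_mul_sWord (A := .ofRange G e) hf, zero_mul, mul_zero]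

theorem IsStarWord.exists_starPath {n : ℕ} {x : LeavittPathAlgebra K G}
    (hx : IsStarWord (p K) (sStar K G) n x) :
    x = 0 ∨ ∃ (β : G.FinitePath) (A : G.GeneralizedVertex), β.length = n ∧
      x = p K A * starPath K β := by
  have h := isLeavittFamily_gen K G
  induction hx with
  | vertex A => exact .inr ⟨.vertex A, A, rfl, (h.b_mul_b_of_subset subset_rfl).symm⟩
  | snoc e _ ih =>
    rcases ih with rfl | ⟨β, A, rfl, rfl⟩
    · exact .inl (zero_mul _)
    · cases β with
      | vertex B =>
        refine .inr ⟨.edges e [] (List.isChain_singleton e), A.inter B, rfl, ?_⟩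
        exact congrArg (· * sStar K G e) (h.p_inter A B)
      | edges f l hl =>
        by_cases hf : G.source f ∈ G.range e
        · exact .inr ⟨.edges e (f :: l) (List.isChain_cons_cons.2 ⟨hf, hl⟩), A, rfl,
            mul_assoc (p K A) (starWord K G f l) (sStar K G e)⟩
        · left
          change p K A * starWord K G f l * sStar K G e = 0
          rw [← h.range_star e, ← mul_assoc, mul_assoc (p K A) (starWord K G f l),
            starWord_mul_p (A := .ofRange G e) hf, mul_zero, zero_mul]

theorem homogeneousPart_eq_wordSpan (n : ℤ) :
    homogeneousPart K G n = wordSpan K (p K) (s K G) (sStar K G) n := by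
  have h := isLeavittFamily_gen K G
  refine le_antisymm (Submodule.span_le.2 ?_) (Submodule.span_le.2 ?_)
  · rintro _ ⟨α, β, A, hn, rfl⟩
    exact Submodule.subset_span ⟨_, _, _, _, h.isWord_mul_b (isWord_sPath α) A,
      isStarWord_starPath β, hn, rfl⟩
  · rintro _ ⟨m, k, x, y, hx, hy, hn, rfl⟩
    rcases hx.exists_sPath with rfl | ⟨α, A, rfl, rfl⟩
    · exact (zero_mul y).symm ▸ zero_mem (homogeneousPart K G n)
    rcases hy.exists_starPath with rfl | ⟨β, B, rfl, rfl⟩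
    · exact (mul_zero (sPath K α * p K A)).symm ▸ zero_mem (homogeneousPart K G n)
    refine Submodule.subset_span ⟨α, β, A.inter B, hn, ?_⟩
    rw [← h.p_inter]
    simp only [mul_assoc]

end Paths

/-! ### The three conditions -/

section Main

variable {K : Type u} [Field K]

theorem isGradedIdeal_span {T : Set (LeavittPathAlgebra K G)} (hT : T ⊆ G.gapElements K) :
    IsGradedIdeal (TwoSidedIdeal.span T) := by
  have h := isLeavittFamily_gen K G
  intro x hx
  simp only [homogeneousPart_eq_wordSpan]
  refine IsLeavittFamily.exists_finsupp_of_mem_span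
    (h.exists_b_mul_eq adjoin_generators_eq_top) _
    (h.span_le_span_homogeneous adjoin_generators_eq_top ?_ hx)
  intro t ht
  obtain ⟨A, S, -, rfl⟩ := hT ht
  exact h.gap_mem_wordSpan A S

theorem canonicalGenerators_subset (I : TwoSidedIdeal (LeavittPathAlgebra K G)) :
    canonicalGenerators I ⊆ I := by
  rintro _ (⟨A, hA, rfl⟩ | ⟨v, ⟨hv, hI⟩, _, rfl⟩)
  · exact hA
  · exact hI

theorem IsGradedIdeal.eq_span {I : TwoSidedIdeal (LeavittPathAlgebra K G)}
    (hI : IsGradedIdeal I) : I = TwoSidedIdeal.span (canonicalGenerators I) := by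
  have h := isLeavittFamily_gen K G
  refine le_antisymm (fun x hx => ?_)
    (TwoSidedIdeal.span_le.2 (canonicalGenerators_subset I))
  set J := TwoSidedIdeal.span (canonicalGenerators I) with hJ
  have hvertex : ∀ A, p K A ∈ I → p K A ∈ J := fun A hA =>
    TwoSidedIdeal.subset_span (Or.inl ⟨A, hA, rfl⟩)
  have hbreak : ∀ v, (G.emitted v).Infinite → ∀ T : Finset E, T.Nonempty →
      (∀ e, e ∈ T ↔ G.source e = v ∧ p K (.ofRange G e) ∉ I) →
      p K (.single G v) - ∑ e ∈ T, s K G e * sStar K G e ∈ I →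
      p K (.single G v) - ∑ e ∈ T, s K G e * sStar K G e ∈ J := by
    intro v hinf T hne hT hTI
    have hout : G.emittedOutside (vertexSet I) v = T := Set.ext fun e => (hT e).symm
    have hv : v ∈ G.breakingVertices (vertexSet I) :=
      ⟨hinf, hout ▸ hne, hout ▸ T.finite_toSet⟩
    have hTeq : hv.2.2.toFinset = T := by
      ext e
      rw [Set.Finite.mem_toFinset, hout, Finset.mem_coe]
    have hb : p K (.single G v) - ∑ e ∈ T, s K G e * sStar K G e =
        breakingElement K (vertexSet I) v hv := by
      rw [breakingElement, gapElement, hTeq]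
    rw [hb] at hTI ⊢
    exact TwoSidedIdeal.subset_span (Or.inr ⟨v, ⟨hv, hTI⟩, hv, rfl⟩)
  have hgap : ∀ (F : Finset E) (A : G.GeneralizedVertex),
      p K A - p K A * ∑ e ∈ F, s K G e * sStar K G e ∈ I →
      p K A - p K A * ∑ e ∈ F, s K G e * sStar K G e ∈ J := by
    classical
    exact fun F A => h.gap_mem hvertex hbreak F (F.image G.source) A
      fun e he _ => Finset.mem_image_of_mem _ he
  obtain ⟨f, hf, rfl⟩ := hI x hx
  refine sum_mem fun n _ => ?_
  have hfn := (hf n).2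
  rw [homogeneousPart_eq_wordSpan] at hfn
  exact h.mem_of_mem_wordSpan (h.exists_b_mul_eq adjoin_generators_eq_top) hgap hfn (hf n).1

theorem exists_gapElements_span_eq (I : TwoSidedIdeal (LeavittPathAlgebra K G)) :
    ∃ T ⊆ G.gapElements K, TwoSidedIdeal.span (canonicalGenerators I) = TwoSidedIdeal.span T := by
  have h := isLeavittFamily_gen K G
  refine ⟨canonicalGenerators I ∩ G.gapElements K, Set.inter_subset_right,
    le_antisymm (TwoSidedIdeal.span_le.2 ?_) (TwoSidedIdeal.span_mono Set.inter_subset_left)⟩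
  rintro x hx
  rcases id hx with ⟨A, hA, rfl⟩ | ⟨v, -, hv, rfl⟩
  -- A gap element needs a vertex `v ∈ A` even when `S` is empty; for `A = ∅` the generator is zero
  -- and needs no witness.
  · rcases A.1.eq_empty_or_nonempty with hAe | ⟨v, hv⟩
    · rw [h.b_eq_zero hAe]
      exact TwoSidedIdeal.zero_mem _
    · refine TwoSidedIdeal.subset_span ⟨hx, A, ∅, ⟨v, hv, by simp⟩, ?_⟩
      rw [gapElement, Finset.sum_empty]
      exact (sub_zero (p K A)).symm
  · refine TwoSidedIdeal.subset_span ⟨hx, .single G v, hv.2.2.toFinset, ⟨v, rfl, fun e he => ?_⟩, rfl⟩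
    exact (hv.2.2.mem_toFinset.1 he).1

end Main

end Ultragraph

theorem mainTheorem2 {K V E : Type*} [Field K] [Countable V] [Countable E]
    (G : Ultragraph V E) (I : TwoSidedIdeal (G.LeavittPathAlgebra K)) :
    List.TFAE [
      Ultragraph.IsGradedIdeal I,
      ∃ T ⊆ G.gapElements K, I = TwoSidedIdeal.span T,
      I = TwoSidedIdeal.span (Ultragraph.canonicalGenerators I)] := by
  tfae_have 1 → 3 := fun hI => hI.eq_span
  tfae_have 3 → 2 := fun hI => by
    obtain ⟨T, hT, hspan⟩ := Ultragraph.exists_gapElements_span_eq I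
    exact ⟨T, hT, hI.trans hspan⟩
  tfae_have 2 → 1 := by
    rintro ⟨T, hT, rfl⟩
    exact Ultragraph.isGradedIdeal_span hT
  tfae_finish
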